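/- Let $N\ge 2$ be an integer and let $A,B,p,q>0$ with $A\ne B$. For $R>0$, a positive function $g\in C^\infty([0,R])$ and $\epsilon>0$, problem (N*) on the ball of radius $R$ with dielectric coefficient $g$ asks for $U_\epsilon\in C^1([0,R])\cap C^\infty((0,R))$ with $$\epsilon^2 g(r)\Big[U_\epsilon''(r)+\Big(\tfrac{N-1}{r}+\tfrac{g'(r)}{g(r)}\Big)U_\epsilon'(r)\Big]=-\rho_\epsilon(r),\quad r\in(0,R),$$ $$\rho_\epsilon(r)=-\frac{R^N}{N}\left(\frac{A e^{pU_\epsilon(r)}}{\int_0^R s^{N-1}e^{pU_\epsilon(s)}\,ds}-\frac{B e^{-qU_\epsilon(r)}}{\int_0^R s^{N-1}e^{-qU_\epsilon(s)}\,ds}\right),$$ $$\int_0^R s^{N-1}U_\epsilon(s)\,ds=0,\qquad U_\epsilon'(0)=0,\qquad U_\epsilon'(R)=\frac{R(A-B)}{\epsilon^2Ng(R)}.$$ Here $A,B,p,q,N,R,g$ do not depend on $\epsilon$. Let $U_\epsilon$ be the solution of (N*) for each $\epsilon>0$, and for $r\in(0,R)$ put $$\mathscr C^+(U_\epsilon;[r,R])=\left|\frac{\int_r^R\rho_\epsilon(s)s^{N-1}\,ds}{U_\epsilon(R)-U_\epsilon(r)}\right|.$$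 The denominator is nonzero for all $\epsilon>0$ and $r\in(0,R)$. Let $D=|B-A|$, let $z=q$ if $A<B$ and $z=p$ if $B<A$, and for $k,R,\gamma>0$ put $$L(k,R,\gamma)=\frac{R^N D z}{2N\Big(1+\frac{2Nk}{RD\gamma z}\Big)\log\Big(1+\frac{RD\gamma z}{2Nk}\Big)}.$$ In (I) and (II), $r_\epsilon$ is any family of points with $r_\epsilon\in(0,R)$ for all $\epsilon>0$. (I) If $\lim_{\epsilon\downarrow0}(R-r_\epsilon)/\epsilon^2=\infty$, then $\lim_{\epsilon\downarrow0}\mathscr C^+(U_\epsilon;[r_\epsilon,R])=0$. (II) If $\lim_{\epsilon\downarrow0}(R-r_\epsilon)/\epsilon^2=\gamma\in(0,\infty)$, then $\lim_{\epsilon\downarrow0}\mathscr C^+(U_\epsilon;[r_\epsilon,R])=L(g(R),R,\gamma)$. Moreover: (i) If $0<\gamma_1<\gamma_2$ and $r^1_\epsilon,r^2_\epsilon\in(0,R)$ satisfy $\lim_{\epsilon\downarrow0}(R-r^i_\epsilon)/\epsilon^2=\gamma_i$ for $i=1,2$, then for all sufficiently small $\epsilon>0$ $$\mathscr C^+(U_\epsilon;[r^2_\epsilon,R])<\mathscr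 C^+(U_\epsilon;[r^1_\epsilon,R])<\frac{R^NDz}{2N}.$$ (ii) Let $0<R_1<R_2$ and $\gamma>0$, and for $i=1,2$ let $U^i_\epsilon$ solve (N*) on the ball of radius $R_i$ with dielectric coefficient $g_i$, with the same $N,A,B,p,q$, where $g_1(R_1)\le g_2(R_2)$ (for example, the two surface dielectric constants are equal). If $r^i_\epsilon\in(0,R_i)$ and $\lim_{\epsilon\downarrow0}(R_i-r^i_\epsilon)/\epsilon^2=\gamma$ for $i=1,2$, then for all sufficiently small $\epsilon>0$ $$\mathscr C^+(U^1_\epsilon;[r^1_\epsilon,R_1])<\mathscr C^+(U^2_\epsilon;[r^2_\epsilon,R_2]).$$ Finally, for fixed $k>0$, $L(k,R,\gamma)$ is strictly decreasing in $\gamma>0$ for each $R>0$, is less than $R^NDz/(2N)$ for all $R,\gamma>0$, and is strictly increasing in $R>0$ for each $\gamma>0$. -/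

import Mathlib

open Filter Topology Set
open scoped ContDiff

namespace ChargeConservingPB

noncomputable section

/-- The net charge density of a radial potential `U` on the ball of radius `R` in dimension `N`
(surface area of the unit sphere normalised to `1`):
`ρ(r) = -(R^N / N) (A e^{pU(r)} / ∫₀ᴿ s^{N-1} e^{pU(s)} ds - B e^{-qU(r)} / ∫₀ᴿ s^{N-1} e^{-qU(s)} ds)`. -/
def chargeDensity (N : ℕ) (A B p q R : ℝ) (U : ℝ → ℝ) (r : ℝ) : ℝ :=
  -(R ^ N / N) *
    (A * Real.exp (p * U r) / (∫ s in (0 : ℝ)..R, s ^ (N - 1) * Real.exp (p * U s)) -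
      B * Real.exp (-(q * U r)) / (∫ s in (0 : ℝ)..R, s ^ (N - 1) * Real.exp (-(q * U s))))

/-- `U ∈ C¹([0,R]) ∩ C^∞((0,R))` solves the radial Neumann problem of the charge-conserving
Poisson–Boltzmann equation with dielectric coefficient `g` and parameter `ε`.
The right-hand side of the equation is `-ρ`. -/
structure IsNeumannSolution (N : ℕ) (A B p q R : ℝ) (g : ℝ → ℝ) (ε : ℝ) (U : ℝ → ℝ) : Prop where
  contDiffOn_closed : ContDiffOn ℝ 1 U (Icc 0 R)
  contDiffOn_open : ContDiffOn ℝ ∞ U (Ioo 0 R)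
  equation : ∀ r ∈ Ioo 0 R,
    ε ^ 2 * g r * (deriv (deriv U) r + (((N : ℝ) - 1) / r + deriv g r / g r) * deriv U r) =
      R ^ N / N *
        (A * Real.exp (p * U r) / (∫ s in (0 : ℝ)..R, s ^ (N - 1) * Real.exp (p * U s)) -
          B * Real.exp (-(q * U r)) / (∫ s in (0 : ℝ)..R, s ^ (N - 1) * Real.exp (-(q * U s))))
  mean_zero : ∫ s in (0 : ℝ)..R, s ^ (N - 1) * U s = 0
  deriv_center : derivWithin U (Icc 0 R) 0 = 0
  deriv_boundary : derivWithin U (Icc 0 R) R = R * (A - B) / (ε ^ 2 * N * g R)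

/-- The capacitance-type quantity of the annular region `[r, R]`:
`|∫_r^R ρ(s) s^{N-1} ds / (U(R) - U(r))|`. -/
def capacitance (N : ℕ) (A B p q R : ℝ) (U : ℝ → ℝ) (r : ℝ) : ℝ :=
  |(∫ s in r..R, chargeDensity N A B p q R U s * s ^ (N - 1)) / (U R - U r)|

/-- The valence that governs the boundary layer: `q` if `A < B`, and `p` if `B < A`. -/
def layerValence (A B p q : ℝ) : ℝ := if A < B then q else p

/-- The explicit limit, for surface dielectric constant `k = g(R)`, concentration difference
`D = |B - A|`, valence `z` and scaled thickness `γ`: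
`R^N D z / (2N (1 + 2Nk / (R D γ z)) log (1 + R D γ z / (2Nk)))`. -/
def limitCapacitance (N : ℕ) (D z k R γ : ℝ) : ℝ :=
  R ^ N * D * z /
    (2 * N * (1 + 2 * N * k / (R * D * γ * z)) * Real.log (1 + R * D * γ * z / (2 * N * k)))

/-- An admissible radial dielectric coefficient on `[0, R]`: smooth and positive. -/
def IsDielectric (R : ℝ) (g : ℝ → ℝ) : Prop :=
  ContDiffOn ℝ ∞ g (Icc 0 R) ∧ ∀ r ∈ Icc 0 R, 0 < g r

/-- `U ε` is the Neumann potential for each `ε > 0`, the other data being independent of `ε`. -/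
def IsNeumannFamily (N : ℕ) (A B p q R : ℝ) (g : ℝ → ℝ) (U : ℝ → ℝ → ℝ) : Prop :=
  ∀ ε : ℝ, 0 < ε → IsNeumannSolution N A B p q R g ε (U ε)

/-- `r ε ∈ (0, R)` and `(R - r ε) / ε² → γ` as `ε ↓ 0`. -/
def HasScaledThickness (R γ : ℝ) (r : ℝ → ℝ) : Prop :=
  (∀ ε : ℝ, 0 < ε → r ε ∈ Ioo 0 R) ∧
    Tendsto (fun ε => (R - r ε) / ε ^ 2) (𝓝[>] 0) (𝓝 γ)

/-- `r ε ∈ (0, R)` and `(R - r ε) / ε² → ∞` as `ε ↓ 0`. -/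
def HasInfiniteScaledThickness (R : ℝ) (r : ℝ → ℝ) : Prop :=
  (∀ ε : ℝ, 0 < ε → r ε ∈ Ioo 0 R) ∧
    Tendsto (fun ε => (R - r ε) / ε ^ 2) (𝓝[>] 0) atTop

end

end ChargeConservingPB

/-! Swapping the two ionic species turns `U` into `-U` and preserves the capacitance, so it suffices
to treat `B < A`. Let V = ε² r^(N-1) g U' be the flux and f the ion difference. The equation reads
V' = r^(N-1) (R^N/N) f, and V runs from 0 at the centre to Q = R^N (A-B)/N at the boundary. Hence
the capacitance is (Q - V(r)) / (U(R) - U(r)), and everything reduces to the boundary layer of V and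
U.

The nonlocal normalisation is what makes this tractable. Let F be a primitive of f in U. Then V²/2 -
ε² (R^N/N) r^(2N-2) g F has derivative -ε² (R^N/N) (r^(2N-2) g)' F. The weighted integral of F is
exactly A/p + B/q, so this energy is O(ε²) uniformly, without pointwise control of `U`
(`IsNeumannSolution.abs_energy_le`). Since `U` increases, the co-ion density is bounded away from
the centre (`IsNeumannSolution.coion_le`), so f = pF + O(1) there. Eliminating F gives ε² V' = (p/2)
V² / (r^(N-1) g) + O(ε²), a nearly closed Riccati equation (`exists_flux_riccati_bound`).

In a layer of thickness O(ε²) the weight may be frozen at R. With κ = p / (2 R^(N-1) g(R)) and t =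
(R-r)/ε², backward stability (`riccati_comparison`) gives V → Q/(1+κQt), and integrating U' gives
U(R) - U(r) → (2/p) log(1+κQt). The quotient is the stated limit, equal to R^N D z/(2N) times φ(x) =
x/((1+x) log(1+x)) at x = κQγ. For thicker regions V stays in [0, Q] while the potential difference
diverges. The comparisons follow from strict monotonicity of φ and of xφ(x), passed from the limits
to small ε. -/

namespace ChargeConservingPB

/-! ### Flux, Boltzmann densities and their energy -/

/-- The weighted flux `ε² r^{N-1} g(r) U'(r)`. -/
noncomputable def flux (N : ℕ) (R : ℝ) (g : ℝ → ℝ) (ε : ℝ) (U : ℝ → ℝ) (r : ℝ) : ℝ :=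
  ε ^ 2 * (r ^ (N - 1) * g r) * derivWithin U (Icc 0 R) r

/-- The total mass `∫₀ᴿ s^{N-1} e^{V(s)} ds` of a Boltzmann density. -/
noncomputable def boltzmannMass (N : ℕ) (R : ℝ) (V : ℝ → ℝ) : ℝ :=
  ∫ s in (0 : ℝ)..R, s ^ (N - 1) * Real.exp (V s)

/-- The normalised difference of the two ionic densities. -/
noncomputable def ionDifference (N : ℕ) (A B p q R : ℝ) (U : ℝ → ℝ) (r : ℝ) : ℝ :=
  A * Real.exp (p * U r) / boltzmannMass N R (fun s => p * U s) -
    B * Real.exp (-(q * U r)) / boltzmannMass N R (fun s => -(q * U s))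

/-- A primitive of the ion difference with respect to the potential. -/
noncomputable def ionEnergy (N : ℕ) (A B p q R : ℝ) (U : ℝ → ℝ) (r : ℝ) : ℝ :=
  A / p * Real.exp (p * U r) / boltzmannMass N R (fun s => p * U s) +
    B / q * Real.exp (-(q * U r)) / boltzmannMass N R (fun s => -(q * U s))

theorem chargeDensity_eq (N : ℕ) (A B p q R : ℝ) (U : ℝ → ℝ) (r : ℝ) :
    chargeDensity N A B p q R U r = -(R ^ N / N * ionDifference N A B p q R U r) := by
  simp only [chargeDensity, ionDifference, boltzmannMass]; ring

theorem boltzmannMass_pos {N : ℕ} {R : ℝ} (hR : 0 < R) {V : ℝ → ℝ}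
    (hV : ContinuousOn V (Icc 0 R)) : 0 < boltzmannMass N R V := by
  apply intervalIntegral.intervalIntegral_pos_of_pos_on _ _ hR
  · apply ContinuousOn.intervalIntegrable
    rw [uIcc_of_le hR.le]
    fun_prop
  · intro x hx
    have := hx.1
    positivity

/-- Each exponential is divided by its own mass, so the total depends on neither `U` nor ε. This is
the L¹ bound behind the uniform energy estimate. -/
theorem integral_ionEnergy {N : ℕ} {A B p q R : ℝ} (hR : 0 < R) {U : ℝ → ℝ}
    (hU : ContinuousOn U (Icc 0 R)) :
    ∫ s in (0 : ℝ)..R, s ^ (N - 1) * ionEnergy N A B p q R U s = A / p + B / q := by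
  have h1 : 0 < boltzmannMass N R (fun s => p * U s) :=
    boltzmannMass_pos hR (continuousOn_const.mul hU)
  have h2 : 0 < boltzmannMass N R (fun s => -(q * U s)) :=
    boltzmannMass_pos hR (continuousOn_const.mul hU).neg
  have e : ∀ s, s ^ (N - 1) * ionEnergy N A B p q R U s =
      A / p / boltzmannMass N R (fun s => p * U s) * (s ^ (N - 1) * Real.exp (p * U s)) +
      B / q / boltzmannMass N R (fun s => -(q * U s)) *
        (s ^ (N - 1) * Real.exp (-(q * U s))) := by
    intro s; simp only [ionEnergy]; ring
  simp only [e]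
  rw [intervalIntegral.integral_add, intervalIntegral.integral_const_mul,
    intervalIntegral.integral_const_mul]
  · change _ * boltzmannMass N R (fun s => p * U s) +
      _ * boltzmannMass N R (fun s => -(q * U s)) = _
    rw [div_mul_cancel₀ _ h1.ne', div_mul_cancel₀ _ h2.ne']
  all_goals
    apply ContinuousOn.intervalIntegrable
    rw [uIcc_of_le hR.le]
    fun_prop

theorem monotoneOn_Icc_of_hasDerivAt {a b : ℝ} {f f' : ℝ → ℝ} (hf : ContinuousOn f (Icc a b))
    (hd : ∀ x ∈ Ioo a b, HasDerivAt f (f' x) x) (h0 : ∀ x ∈ Ioo a b, 0 ≤ f' x) :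
    MonotoneOn f (Icc a b) := by
  apply monotoneOn_of_deriv_nonneg (convex_Icc a b) hf
  · rw [interior_Icc]
    exact fun x hx => (hd x hx).differentiableAt.differentiableWithinAt
  · rw [interior_Icc]
    intro x hx
    rw [(hd x hx).deriv]
    exact h0 x hx

/-! ### Regularity of the dielectric weight -/

section Dielectric

variable {N : ℕ} {R : ℝ} {g : ℝ → ℝ}

theorem IsDielectric.hasDerivAt (hg : IsDielectric R g) {r : ℝ} (hr : r ∈ Ioo 0 R) :
    HasDerivAt g (deriv g r) r :=
  ((hg.1.contDiffAt (Icc_mem_nhds hr.1 hr.2)).differentiableAt (by simp)).hasDerivAt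

theorem IsDielectric.exists_deriv_bound (hg : IsDielectric R g) (hR : 0 < R) :
    ∃ C, 0 ≤ C ∧ ∀ r ∈ Ioo 0 R, |deriv g r| ≤ C := by
  have hc : ContinuousOn (derivWithin g (Icc 0 R)) (Icc 0 R) :=
    hg.1.continuousOn_derivWithin (uniqueDiffOn_Icc hR) (by simp)
  obtain ⟨C, hC⟩ := isCompact_Icc.exists_bound_of_continuousOn hc
  refine ⟨C, (norm_nonneg _).trans (hC 0 (left_mem_Icc.2 hR.le)), fun r hr => ?_⟩
  rw [← derivWithin_of_mem_nhds (Icc_mem_nhds hr.1 hr.2)]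
  exact hC r (Ioo_subset_Icc_self hr)

/-- The weight `r^{2N-2} g` has derivative of order `r^{N-1}`. -/
theorem IsDielectric.exists_weight_deriv_bound (hg : IsDielectric R g) (hR : 0 < R)
    (hN : 2 ≤ N) :
    ∃ C, 0 ≤ C ∧ ∀ r ∈ Ioo 0 R, ∃ d, |d| ≤ C * r ^ (N - 1) ∧
      HasDerivAt (fun s => s ^ (N - 1) * (s ^ (N - 1) * g s)) d r := by
  obtain ⟨C₁, h1, hC₁⟩ := hg.exists_deriv_bound hR
  obtain ⟨C₂, hC₂⟩ := isCompact_Icc.exists_bound_of_continuousOn hg.1.continuousOn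
  have h2 : 0 ≤ C₂ := (norm_nonneg _).trans (hC₂ 0 (left_mem_Icc.2 hR.le))
  obtain ⟨n, rfl⟩ : ∃ n, N = n + 2 := ⟨N - 2, by omega⟩
  refine ⟨2 * (n + 1) * R ^ n * C₂ + R ^ (n + 1) * C₁, by positivity, fun r hr => ?_⟩
  have hr0 := hr.1
  have hp : HasDerivAt (fun s : ℝ => s ^ (n + 1)) ((n + 1) * r ^ n) r := by
    simpa using hasDerivAt_pow (n + 1) r
  refine ⟨_, ?_, hp.mul (hp.mul (hg.hasDerivAt hr))⟩
  have e : (n + 1) * r ^ n * (r ^ (n + 1) * g r) +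
      r ^ (n + 1) * ((n + 1) * r ^ n * g r + r ^ (n + 1) * deriv g r) =
      r ^ (n + 1) * (2 * (n + 1) * r ^ n * g r + r ^ (n + 1) * deriv g r) := by ring
  have hgr : |g r| ≤ C₂ := hC₂ r (Ioo_subset_Icc_self hr)
  have hgd := hC₁ r hr
  simp only [show n + 2 - 1 = n + 1 from rfl]
  rw [e, abs_mul, abs_of_pos (pow_pos hr0 _), mul_comm]
  gcongr
  refine (abs_add_le _ _).trans ?_
  rw [abs_mul _ (g r), abs_mul _ (deriv g r), abs_of_pos (show 0 < 2 * ((n : ℝ) + 1) * r ^ n by positivity),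
    abs_of_pos (show 0 < r ^ (n + 1) by positivity)]
  have := hr.2.le
  gcongr

end Dielectric

/-! ### Flux equation, monotonicity and species symmetry for one solution -/

section Solution

variable {N : ℕ} {A B p q R ε : ℝ} {g U : ℝ → ℝ}

theorem IsNeumannSolution.continuousOn (S : IsNeumannSolution N A B p q R g ε U) :
    ContinuousOn U (Icc 0 R) := S.contDiffOn_closed.continuousOn

theorem IsNeumannSolution.hasDerivAt (S : IsNeumannSolution N A B p q R g ε U) {r : ℝ}
    (hr : r ∈ Ioo 0 R) : HasDerivAt U (derivWithin U (Icc 0 R) r) r := by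
  rw [derivWithin_of_mem_nhds (Icc_mem_nhds hr.1 hr.2)]
  exact ((S.contDiffOn_open.contDiffAt (isOpen_Ioo.mem_nhds hr)).differentiableAt
    (by simp)).hasDerivAt

theorem IsNeumannSolution.continuousOn_flux (S : IsNeumannSolution N A B p q R g ε U)
    (hg : IsDielectric R g) (hR : 0 < R) : ContinuousOn (flux N R g ε U) (Icc 0 R) := by
  have hc : ContinuousOn (derivWithin U (Icc 0 R)) (Icc 0 R) :=
    S.contDiffOn_closed.continuousOn_derivWithin (uniqueDiffOn_Icc hR) le_rfl
  have hgc := hg.1.continuousOn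
  unfold flux
  fun_prop

theorem IsNeumannSolution.continuousOn_ionDifference (S : IsNeumannSolution N A B p q R g ε U) :
    ContinuousOn (ionDifference N A B p q R U) (Icc 0 R) := by
  have := S.continuousOn
  unfold ionDifference
  fun_prop

theorem IsNeumannSolution.continuousOn_ionEnergy (S : IsNeumannSolution N A B p q R g ε U) :
    ContinuousOn (ionEnergy N A B p q R U) (Icc 0 R) := by
  have := S.continuousOn
  unfold ionEnergy
  fun_prop

theorem IsNeumannSolution.hasDerivAt_flux (S : IsNeumannSolution N A B p q R g ε U)
    (hg : IsDielectric R g) (hN : 2 ≤ N) {r : ℝ} (hr : r ∈ Ioo 0 R) :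
    HasDerivAt (flux N R g ε U)
      (r ^ (N - 1) * (R ^ N / N * ionDifference N A B p q R U r)) r := by
  have hr0 := hr.1
  have hgr := hg.2 r (Ioo_subset_Icc_self hr)
  have heq : flux N R g ε U =ᶠ[𝓝 r] fun s => ε ^ 2 * (s ^ (N - 1) * g s) * deriv U s := by
    filter_upwards [isOpen_Ioo.mem_nhds hr] with s hs
    rw [flux, derivWithin_of_mem_nhds (Icc_mem_nhds hs.1 hs.2)]
  refine HasDerivAt.congr_of_eventuallyEq ?_ heq
  have hd : HasDerivAt (deriv U) (deriv (deriv U) r) r := by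
    have : ContDiffOn ℝ ∞ (deriv U) (Ioo 0 R) :=
      S.contDiffOn_open.deriv_of_isOpen isOpen_Ioo (by simp)
    exact ((this.contDiffAt (isOpen_Ioo.mem_nhds hr)).differentiableAt (by simp)).hasDerivAt
  obtain ⟨n, rfl⟩ : ∃ n, N = n + 2 := ⟨N - 2, by omega⟩
  have hp : HasDerivAt (fun s : ℝ => s ^ (n + 1)) ((n + 1) * r ^ n) r := by
    simpa using hasDerivAt_pow (n + 1) r
  have h := ((hp.mul (hg.hasDerivAt hr)).const_mul (ε ^ 2)).mul hd
  refine h.congr_deriv ?_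
  have eqn := S.equation r hr
  simp only [ionDifference, boltzmannMass]
  rw [← eqn]
  simp only [show n + 2 - 1 = n + 1 from rfl, Pi.mul_apply]
  push_cast
  field_simp
  ring

theorem flux_zero (hN : 2 ≤ N) : flux N R g ε U 0 = 0 := by
  simp [flux, show N - 1 ≠ 0 by omega]

theorem IsNeumannSolution.flux_boundary (S : IsNeumannSolution N A B p q R g ε U)
    (hg : IsDielectric R g) (hR : 0 < R) (hN : 2 ≤ N) (hε : 0 < ε) :
    flux N R g ε U R = R ^ N / N * (A - B) := by
  have hgR := hg.2 R (right_mem_Icc.2 hR.le)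
  rw [flux, S.deriv_boundary]
  obtain ⟨n, rfl⟩ : ∃ n, N = n + 2 := ⟨N - 2, by omega⟩
  simp only [show n + 2 - 1 = n + 1 from rfl]
  push_cast
  field_simp
  ring

theorem IsNeumannSolution.integral_charge (S : IsNeumannSolution N A B p q R g ε U)
    (hg : IsDielectric R g) (hN : 2 ≤ N) (hR : 0 < R) {r : ℝ} (hr : r ∈ Ioo 0 R) :
    ∫ s in r..R, chargeDensity N A B p q R U s * s ^ (N - 1) =
      flux N R g ε U r - flux N R g ε U R := by
  have hsub : Icc r R ⊆ Icc 0 R := Icc_subset_Icc_left hr.1.le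
  have h := intervalIntegral.integral_eq_sub_of_hasDerivAt_of_le hr.2.le
    ((S.continuousOn_flux hg hR).mono hsub)
    (fun x hx => S.hasDerivAt_flux hg hN ⟨hr.1.trans hx.1, hx.2⟩) (by
      apply ContinuousOn.intervalIntegrable
      rw [uIcc_of_le hr.2.le]
      have := S.continuousOn_ionDifference.mono hsub
      fun_prop)
  rw [← neg_sub, ← h, ← intervalIntegral.integral_neg]
  congr 1
  ext s
  rw [chargeDensity_eq]
  ring

theorem IsNeumannSolution.hasDerivAt_ionDifference (S : IsNeumannSolution N A B p q R g ε U)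
    {r : ℝ} (hr : r ∈ Ioo 0 R) :
    HasDerivAt (ionDifference N A B p q R U)
      ((A * p * Real.exp (p * U r) / boltzmannMass N R (fun s => p * U s) +
        B * q * Real.exp (-(q * U r)) / boltzmannMass N R (fun s => -(q * U s))) *
          derivWithin U (Icc 0 R) r) r := by
  have hU := S.hasDerivAt hr
  have h1 := ((hU.const_mul p).exp.const_mul A).div_const
    (boltzmannMass N R (fun s => p * U s))
  have h2 := ((hU.const_mul q).fun_neg.exp.const_mul B).div_const
    (boltzmannMass N R (fun s => -(q * U s)))
  exact (h1.sub h2).congr_deriv (by ring)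

theorem IsNeumannSolution.hasDerivAt_ionEnergy (S : IsNeumannSolution N A B p q R g ε U)
    (hp : 0 < p) (hq : 0 < q) {r : ℝ} (hr : r ∈ Ioo 0 R) :
    HasDerivAt (ionEnergy N A B p q R U)
      (ionDifference N A B p q R U r * derivWithin U (Icc 0 R) r) r := by
  have hU := S.hasDerivAt hr
  have h1 := ((hU.const_mul p).exp.const_mul (A / p)).div_const
    (boltzmannMass N R (fun s => p * U s))
  have h2 := ((hU.const_mul q).fun_neg.exp.const_mul (B / q)).div_const
    (boltzmannMass N R (fun s => -(q * U s)))
  refine (h1.add h2).congr_deriv ?_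
  simp only [ionDifference]
  field_simp
  ring

/-- Write V for the flux and f for the ion difference. Both V'f and Vf' are nonnegative: the first
is a multiple of f², and the second of U'², because f increases with the potential. So Vf increases
from 0, is nonnegative, and (V²)' is a nonnegative multiple of Vf. -/
theorem IsNeumannSolution.monotoneOn_flux_sq (S : IsNeumannSolution N A B p q R g ε U)
    (hg : IsDielectric R g) (hN : 2 ≤ N) (hR : 0 < R) (hA : 0 < A) (hB : 0 < B)
    (hp : 0 < p) (hq : 0 < q) :
    MonotoneOn (fun r => flux N R g ε U r ^ 2) (Icc 0 R) := by
  have h1 : 0 < boltzmannMass N R (fun s => p * U s) :=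
    boltzmannMass_pos hR (continuousOn_const.mul S.continuousOn)
  have h2 : 0 < boltzmannMass N R (fun s => -(q * U s)) :=
    boltzmannMass_pos hR (continuousOn_const.mul S.continuousOn).neg
  have hmono : MonotoneOn (fun r => flux N R g ε U r * ionDifference N A B p q R U r)
      (Icc 0 R) := by
    refine monotoneOn_Icc_of_hasDerivAt
      ((S.continuousOn_flux hg hR).mul S.continuousOn_ionDifference)
      (fun r hr => (S.hasDerivAt_flux hg hN hr).mul (S.hasDerivAt_ionDifference hr)) ?_
    intro r hr
    have hr0 := hr.1
    have hgr := hg.2 r (Ioo_subset_Icc_self hr)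
    have e1 : r ^ (N - 1) * (R ^ N / N * ionDifference N A B p q R U r) *
        ionDifference N A B p q R U r =
        r ^ (N - 1) * (R ^ N / N) * ionDifference N A B p q R U r ^ 2 := by ring
    rw [e1, flux]
    refine add_nonneg (by positivity) ?_
    have : 0 ≤ ε ^ 2 * (r ^ (N - 1) * g r) *
      (A * p * Real.exp (p * U r) / boltzmannMass N R (fun s => p * U s) +
        B * q * Real.exp (-(q * U r)) / boltzmannMass N R (fun s => -(q * U s))) *
          derivWithin U (Icc 0 R) r ^ 2 := by positivity
    linarith
  refine monotoneOn_Icc_of_hasDerivAt ((S.continuousOn_flux hg hR).pow 2)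
    (fun r hr => (S.hasDerivAt_flux hg hN hr).pow 2) ?_
  intro r hr
  have hr0 := hr.1
  have := hmono (left_mem_Icc.2 hR.le) (Ioo_subset_Icc_self hr) hr.1.le
  simp only [flux_zero hN, zero_mul] at this
  have h3 : 0 ≤ 2 * (r ^ (N - 1) * (R ^ N / N)) *
    (flux N R g ε U r * ionDifference N A B p q R U r) := by positivity
  simp only [Nat.cast_ofNat, Nat.add_one_sub_one, pow_one]
  linarith

/-- The boundary flux is positive, so a negative value would be followed by a zero, against
monotonicity of the square. -/
theorem IsNeumannSolution.flux_nonneg (S : IsNeumannSolution N A B p q R g ε U)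
    (hg : IsDielectric R g) (hN : 2 ≤ N) (hR : 0 < R) (hA : 0 < A) (hB : 0 < B)
    (hp : 0 < p) (hq : 0 < q) (hBA : B < A) (hε : 0 < ε) {r : ℝ} (hr : r ∈ Icc 0 R) :
    0 ≤ flux N R g ε U r := by
  by_contra! hneg
  have hQ : 0 < flux N R g ε U R := by
    rw [S.flux_boundary hg hR hN hε]
    have : 0 < A - B := sub_pos.2 hBA
    have : (0 : ℝ) < N := by exact_mod_cast (by omega : 0 < N)
    positivity
  obtain ⟨s, hs, hs0⟩ := intermediate_value_Icc hr.2
    ((S.continuousOn_flux hg hR).mono (Icc_subset_Icc_left hr.1)) ⟨hneg.le, hQ.le⟩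
  have := S.monotoneOn_flux_sq hg hN hR hA hB hp hq hr ⟨hr.1.trans hs.1, hs.2⟩ hs.1
  simp only [hs0] at this
  nlinarith

theorem IsNeumannSolution.monotoneOn_flux (S : IsNeumannSolution N A B p q R g ε U)
    (hg : IsDielectric R g) (hN : 2 ≤ N) (hR : 0 < R) (hA : 0 < A) (hB : 0 < B)
    (hp : 0 < p) (hq : 0 < q) (hBA : B < A) (hε : 0 < ε) :
    MonotoneOn (flux N R g ε U) (Icc 0 R) := fun _ hr _ hs hrs =>
  (pow_le_pow_iff_left₀ (S.flux_nonneg hg hN hR hA hB hp hq hBA hε hr)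
    (S.flux_nonneg hg hN hR hA hB hp hq hBA hε hs) two_ne_zero).1
    (S.monotoneOn_flux_sq hg hN hR hA hB hp hq hr hs hrs)

theorem IsNeumannSolution.flux_le (S : IsNeumannSolution N A B p q R g ε U)
    (hg : IsDielectric R g) (hN : 2 ≤ N) (hR : 0 < R) (hA : 0 < A) (hB : 0 < B)
    (hp : 0 < p) (hq : 0 < q) (hBA : B < A) (hε : 0 < ε) {r : ℝ} (hr : r ∈ Icc 0 R) :
    flux N R g ε U r ≤ R ^ N / N * (A - B) := by
  rw [← S.flux_boundary hg hR hN hε]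
  exact S.monotoneOn_flux hg hN hR hA hB hp hq hBA hε hr (right_mem_Icc.2 hR.le) hr.2

theorem IsNeumannSolution.monotoneOn (S : IsNeumannSolution N A B p q R g ε U)
    (hg : IsDielectric R g) (hN : 2 ≤ N) (hR : 0 < R) (hA : 0 < A) (hB : 0 < B)
    (hp : 0 < p) (hq : 0 < q) (hBA : B < A) (hε : 0 < ε) : MonotoneOn U (Icc 0 R) := by
  refine monotoneOn_Icc_of_hasDerivAt S.continuousOn (fun r hr => S.hasDerivAt hr) ?_
  intro r hr
  have hr0 := hr.1
  have hgr := hg.2 r (Ioo_subset_Icc_self hr)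
  have h := S.flux_nonneg hg hN hR hA hB hp hq hBA hε (Ioo_subset_Icc_self hr)
  exact nonneg_of_mul_nonneg_right h (by positivity)

/-- Equality would make the monotone `U` constant on `[r, R]`, with zero one-sided derivative at
`R`, while the Neumann datum there is positive. -/
theorem IsNeumannSolution.lt_boundary (S : IsNeumannSolution N A B p q R g ε U)
    (hg : IsDielectric R g) (hN : 2 ≤ N) (hR : 0 < R) (hA : 0 < A) (hB : 0 < B)
    (hp : 0 < p) (hq : 0 < q) (hBA : B < A) (hε : 0 < ε) {r : ℝ} (hr : r ∈ Ioo 0 R) :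
    U r < U R := by
  have hmono := S.monotoneOn hg hN hR hA hB hp hq hBA hε
  have hRm : R ∈ Icc 0 R := right_mem_Icc.2 hR.le
  refine (hmono (Ioo_subset_Icc_self hr) hRm hr.2.le).lt_of_ne fun heq => ?_
  have hgR := hg.2 R hRm
  have hd : HasDerivWithinAt U (derivWithin U (Icc 0 R) R) (Icc r R) R :=
    (((S.contDiffOn_closed.differentiableOn one_ne_zero) R hRm).hasDerivWithinAt).mono
      (Icc_subset_Icc_left hr.1.le)
  have hc : HasDerivWithinAt U 0 (Icc r R) R := by
    refine (hasDerivWithinAt_const R (Icc r R) (U R)).congr (fun s hs => ?_) rfl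
    have hs' : s ∈ Icc 0 R := ⟨hr.1.le.trans hs.1, hs.2⟩
    exact le_antisymm (hmono hs' hRm hs.2)
      (heq ▸ hmono (Ioo_subset_Icc_self hr) hs' hs.1)
  have h0 := (uniqueDiffOn_Icc hr.2 R (right_mem_Icc.2 hr.2.le)).eq_deriv _ hd hc
  rw [S.deriv_boundary] at h0
  have : 0 < A - B := sub_pos.2 hBA
  have : (0 : ℝ) < N := by exact_mod_cast (by omega : 0 < N)
  have : 0 < R * (A - B) / (ε ^ 2 * N * g R) := by positivity
  linarith

/-- Exchanging the species together with their valences is what reduces `A < B` to `B < A`. -/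
theorem IsNeumannSolution.neg (S : IsNeumannSolution N A B p q R g ε U) :
    IsNeumannSolution N B A q p R g ε (fun r => -U r) where
  contDiffOn_closed := S.contDiffOn_closed.neg
  contDiffOn_open := S.contDiffOn_open.neg
  equation r hr := by
    have h := S.equation r hr
    have e : deriv (fun r => -U r) = fun r => -deriv U r := by ext s; exact deriv.fun_neg
    rw [e, deriv.fun_neg]
    simp only [mul_neg, neg_neg]
    linear_combination -h
  mean_zero := by simp [S.mean_zero]
  deriv_center := by rw [derivWithin.fun_neg, S.deriv_center, neg_zero]
  deriv_boundary := by rw [derivWithin.fun_neg, S.deriv_boundary]; ring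

theorem capacitance_neg (N : ℕ) (A B p q R : ℝ) (U : ℝ → ℝ) (r : ℝ) :
    capacitance N B A q p R (fun r => -U r) r = capacitance N A B p q R U r := by
  have e : ∀ s, chargeDensity N B A q p R (fun r => -U r) s * s ^ (N - 1) =
      -(chargeDensity N A B p q R U s * s ^ (N - 1)) := by
    intro s; simp only [chargeDensity, mul_neg, neg_neg]; ring
  simp only [capacitance, e, intervalIntegral.integral_neg]
  rw [show -U R - -U r = -(U R - U r) by ring, neg_div_neg_eq]

end Solution

/-! ### Energy and co-ion estimates, uniform in ε -/

theorem ionEnergy_nonneg {N : ℕ} {A B p q R : ℝ} {U : ℝ → ℝ} (hR : 0 < R)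
    (hU : ContinuousOn U (Icc 0 R)) (hA : 0 < A) (hB : 0 < B) (hp : 0 < p) (hq : 0 < q) (r : ℝ) :
    0 ≤ ionEnergy N A B p q R U r := by
  have h1 : 0 < boltzmannMass N R (fun s => p * U s) :=
    boltzmannMass_pos hR (continuousOn_const.mul hU)
  have h2 : 0 < boltzmannMass N R (fun s => -(q * U s)) :=
    boltzmannMass_pos hR (continuousOn_const.mul hU).neg
  unfold ionEnergy
  positivity

section Solution

variable {N : ℕ} {A B p q R ε : ℝ} {g U : ℝ → ℝ}

/-- Approximate conservation of energy, uniformly on `[0, R]`. -/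
theorem IsNeumannSolution.abs_energy_le (S : IsNeumannSolution N A B p q R g ε U)
    (hg : IsDielectric R g) (hN : 2 ≤ N) (hR : 0 < R) (hA : 0 < A) (hB : 0 < B)
    (hp : 0 < p) (hq : 0 < q) {C : ℝ} (hC0 : 0 ≤ C)
    (hC : ∀ r ∈ Ioo 0 R, ∃ d, |d| ≤ C * r ^ (N - 1) ∧
      HasDerivAt (fun s => s ^ (N - 1) * (s ^ (N - 1) * g s)) d r) {r : ℝ} (hr : r ∈ Icc 0 R) :
    |flux N R g ε U r ^ 2 / 2 - ε ^ 2 * (R ^ N / N) *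
      ((r ^ (N - 1) * (r ^ (N - 1) * g r)) * ionEnergy N A B p q R U r)| ≤
      ε ^ 2 * (R ^ N / N) * C * (A / p + B / q) := by
  have hFc := S.continuousOn_ionEnergy
  have hF0 := ionEnergy_nonneg (N := N) hR S.continuousOn hA hB hp hq
  have hgc := hg.1.continuousOn
  have hVc := S.continuousOn_flux hg hR
  choose! d hd hW using hC
  set E : ℝ → ℝ := fun r => flux N R g ε U r ^ 2 / 2 - ε ^ 2 * (R ^ N / N) *
      ((r ^ (N - 1) * (r ^ (N - 1) * g r)) * ionEnergy N A B p q R U r) with hE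
  have hEc : ContinuousOn E (Icc 0 R) := by fun_prop
  -- The terms containing the ion difference cancel; only the derivative of the weight survives.
  have hEd : ∀ x ∈ Ioo 0 R, HasDerivAt E
      (-(ε ^ 2 * (R ^ N / N) * d x * ionEnergy N A B p q R U x)) x := by
    intro x hx
    refine ((((S.hasDerivAt_flux hg hN hx).pow 2).div_const 2).sub
      (((hW x hx).mul (S.hasDerivAt_ionEnergy hp hq hx)).const_mul _)).congr_deriv ?_
    simp only [flux]
    push_cast
    ring
  set G : ℝ → ℝ := fun r => ∫ s in (0 : ℝ)..r, s ^ (N - 1) * ionEnergy N A B p q R U s with hG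
  have hic : ContinuousOn (fun s => s ^ (N - 1) * ionEnergy N A B p q R U s) (Icc 0 R) := by
    fun_prop
  have hii : IntervalIntegrable (fun s => s ^ (N - 1) * ionEnergy N A B p q R U s)
      MeasureTheory.volume 0 R := by
    apply ContinuousOn.intervalIntegrable
    rwa [uIcc_of_le hR.le]
  have hGc : ContinuousOn G (Icc 0 R) := by
    have := intervalIntegral.continuousOn_primitive_interval' hii left_mem_uIcc
    rwa [uIcc_of_le hR.le] at this
  have hGd : ∀ x ∈ Ioo 0 R, HasDerivAt G (x ^ (N - 1) * ionEnergy N A B p q R U x) x := by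
    intro x hx
    apply intervalIntegral.integral_hasDerivAt_right
    · exact hii.mono_set (by
        rw [uIcc_of_le hR.le, uIcc_of_le hx.1.le]; exact Icc_subset_Icc_right hx.2.le)
    · exact (hic.mono Ioo_subset_Icc_self).stronglyMeasurableAtFilter isOpen_Ioo x hx
    · exact hic.continuousAt (Icc_mem_nhds hx.1 hx.2)
  have hGR : G R = A / p + B / q := integral_ionEnergy hR S.continuousOn
  have hK : 0 ≤ ε ^ 2 * (R ^ N / N) := by positivity
  have hGm : MonotoneOn G (Icc 0 R) := monotoneOn_Icc_of_hasDerivAt hGc hGd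
    fun x hx => mul_nonneg (pow_nonneg hx.1.le _) (hF0 x)
  have key : ∀ x ∈ Ioo 0 R, |ε ^ 2 * (R ^ N / N) * d x * ionEnergy N A B p q R U x| ≤
      ε ^ 2 * (R ^ N / N) * C * (x ^ (N - 1) * ionEnergy N A B p q R U x) := by
    intro x hx
    rw [abs_mul, abs_mul, abs_of_nonneg hK, abs_of_nonneg (hF0 x)]
    have := mul_le_mul_of_nonneg_left (hd x hx) hK
    have := mul_le_mul_of_nonneg_right this (hF0 x)
    linarith
  -- The weight derivative `d` is chosen pointwise, so E' is not integrated: instead |E'| ≤ const ·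
  -- G' makes both const · G ± E monotone.
  have m1 : MonotoneOn (fun x => ε ^ 2 * (R ^ N / N) * C * G x + E x) (Icc 0 R) :=
    monotoneOn_Icc_of_hasDerivAt ((continuousOn_const.mul hGc).add hEc)
      (fun x hx => ((hGd x hx).const_mul _).add (hEd x hx))
      fun x hx => by have := (abs_le.1 (key x hx)).2; linarith
  have m2 : MonotoneOn (fun x => ε ^ 2 * (R ^ N / N) * C * G x - E x) (Icc 0 R) :=
    monotoneOn_Icc_of_hasDerivAt ((continuousOn_const.mul hGc).sub hEc)
      (fun x hx => ((hGd x hx).const_mul _).sub (hEd x hx))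
      fun x hx => by have := (abs_le.1 (key x hx)).1; linarith
  have h0 : (0 : ℝ) ∈ Icc 0 R := left_mem_Icc.2 hR.le
  have hG0 : G 0 = 0 := by simp [hG]
  have hE0 : E 0 = 0 := by simp [hE, flux_zero hN, show N - 1 ≠ 0 by omega]
  have a1 := m1 h0 hr hr.1
  have a2 := m2 h0 hr hr.1
  have a3 := mul_le_mul_of_nonneg_left (hGm hr (right_mem_Icc.2 hR.le) hr.2) (mul_nonneg hK hC0)
  simp only [hG0, hE0] at a1 a2
  rw [hGR] at a3
  change |E r| ≤ _
  exact abs_le.2 ⟨by linarith, by linarith⟩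

/-- The co-ion density stays bounded away from the centre. -/
theorem IsNeumannSolution.coion_le (S : IsNeumannSolution N A B p q R g ε U)
    (hg : IsDielectric R g) (hN : 2 ≤ N) (hR : 0 < R) (hA : 0 < A) (hB : 0 < B)
    (hp : 0 < p) (hq : 0 < q) (hBA : B < A) (hε : 0 < ε) {r : ℝ} (hr : r ∈ Ioo 0 R) :
    B * Real.exp (-(q * U r)) / boltzmannMass N R (fun s => -(q * U s)) ≤ B * N / r ^ N := by
  have hr0 := hr.1
  have hN0 : (0 : ℝ) < N := by exact_mod_cast (by omega : 0 < N)
  have hmono := S.monotoneOn hg hN hR hA hB hp hq hBA hε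
  have hUc := S.continuousOn
  have h2 : 0 < boltzmannMass N R (fun s => -(q * U s)) :=
    boltzmannMass_pos hR (continuousOn_const.mul hUc).neg
  have hc : ContinuousOn (fun s => s ^ (N - 1) * Real.exp (-(q * U s))) (Icc 0 R) := by
    fun_prop
  have hii : IntervalIntegrable (fun s => s ^ (N - 1) * Real.exp (-(q * U s)))
      MeasureTheory.volume 0 R := by
    apply ContinuousOn.intervalIntegrable
    rwa [uIcc_of_le hR.le]
  have i1 : IntervalIntegrable (fun s => s ^ (N - 1) * Real.exp (-(q * U s)))
      MeasureTheory.volume 0 r := hii.mono_set (by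
    rw [uIcc_of_le hR.le, uIcc_of_le hr0.le]; exact Icc_subset_Icc_right hr.2.le)
  have i2 : IntervalIntegrable (fun s => s ^ (N - 1) * Real.exp (-(q * U s)))
      MeasureTheory.volume r R := hii.mono_set (by
    rw [uIcc_of_le hR.le, uIcc_of_le hr.2.le]; exact Icc_subset_Icc_left hr0.le)
  -- As `U` increases, the co-ion exponential on `[0, r]` is at least its value at `r`; the mass of
  -- this ball alone gives the bound.
  have b1 : ∫ s in (0 : ℝ)..r, s ^ (N - 1) * Real.exp (-(q * U r)) ≤
      ∫ s in (0 : ℝ)..r, s ^ (N - 1) * Real.exp (-(q * U s)) := by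
    apply intervalIntegral.integral_mono_on hr0.le
      (Continuous.intervalIntegrable (by fun_prop) _ _) i1
    intro s hs
    have := hs.1
    have hU := hmono ⟨hs.1, hs.2.trans hr.2.le⟩ (Ioo_subset_Icc_self hr) hs.2
    gcongr
  have b2 : 0 ≤ ∫ s in r..R, s ^ (N - 1) * Real.exp (-(q * U s)) :=
    intervalIntegral.integral_nonneg hr.2.le fun s hs => by
      have := hr0.le.trans hs.1
      positivity
  have b3 := intervalIntegral.integral_add_adjacent_intervals i1 i2
  rw [intervalIntegral.integral_mul_const, integral_pow,
    show N - 1 + 1 = N by omega, show ((N - 1 : ℕ) : ℝ) + 1 = N by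
      rw [Nat.cast_sub (by omega)]; simp, zero_pow (by omega), sub_zero] at b1
  have b4 : r ^ N / N * Real.exp (-(q * U r)) ≤ boltzmannMass N R (fun s => -(q * U s)) := by
    unfold boltzmannMass; linarith
  rw [div_le_div_iff₀ h2 (by positivity)]
  have := mul_le_mul_of_nonneg_left b4 (show 0 ≤ B * N by positivity)
  refine le_trans (le_of_eq ?_) this
  field_simp

end Solution

/-! ### Riccati asymptotics in the boundary layer -/

section Family

variable {N : ℕ} {A B p q R : ℝ} {g : ℝ → ℝ}

/-- Near the boundary the flux satisfies a Riccati equation up to an error of order `ε²`. -/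
theorem exists_flux_riccati_bound (hg : IsDielectric R g) (hN : 2 ≤ N) (hR : 0 < R)
    (hA : 0 < A) (hB : 0 < B) (hp : 0 < p) (hq : 0 < q) (hBA : B < A) :
    ∃ C, 0 ≤ C ∧ ∀ ε U, 0 < ε → IsNeumannSolution N A B p q R g ε U → ∀ r ∈ Ioo (R / 2) R,
      |ε ^ 2 * (r ^ (N - 1) * (R ^ N / N * ionDifference N A B p q R U r)) -
        p / 2 * flux N R g ε U r ^ 2 * (r ^ (N - 1) * g r)⁻¹| ≤ C * ε ^ 2 := by
  obtain ⟨C, hC0, hC⟩ := hg.exists_weight_deriv_bound hR hN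
  have hN0 : (0 : ℝ) < N := by exact_mod_cast (by omega : 0 < N)
  have hsub : Icc (R / 2) R ⊆ Icc 0 R := Icc_subset_Icc_left (by positivity)
  have hpos : ∀ r ∈ Icc (R / 2) R, 0 < r ^ (N - 1) * g r := fun r hr =>
    mul_pos (pow_pos ((half_pos hR).trans_le hr.1) _) (hg.2 r (hsub hr))
  have hgc := hg.1.continuousOn.mono hsub
  have hc : ContinuousOn (fun r => (r ^ (N - 1) * g r)⁻¹) (Icc (R / 2) R) :=
    ContinuousOn.inv₀ (by fun_prop) fun r hr => (hpos r hr).ne'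
  obtain ⟨M, hM⟩ := isCompact_Icc.exists_bound_of_continuousOn hc
  have hM0 : 0 ≤ M := (norm_nonneg _).trans (hM R ⟨by linarith, le_rfl⟩)
  -- The first summand pays for the energy error, the second for the co-ions. Staying in `r ≥ R / 2`
  -- keeps both the inverse weight and the co-ion bound finite.
  refine ⟨p * M * ((R ^ N / N) * C * (A / p + B / q)) +
    R ^ (N - 1) * (R ^ N / N) * (1 + p / q) * (B * N / (R / 2) ^ N), by positivity, ?_⟩
  intro ε U hε S r hr
  have hrI := Ioo_subset_Icc_self hr
  have hr' : r ∈ Ioo 0 R := ⟨(half_pos hR).trans hr.1, hr.2⟩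
  have hr0 := hr'.1
  have hh := hpos r hrI
  have e1 := S.abs_energy_le hg hN hR hA hB hp hq hC0 hC (hsub hrI)
  have e2 := S.coion_le hg hN hR hA hB hp hq hBA hε hr'
  have h2 : 0 < boltzmannMass N R (fun s => -(q * U s)) :=
    boltzmannMass_pos hR (continuousOn_const.mul S.continuousOn).neg
  set E := flux N R g ε U r ^ 2 / 2 - ε ^ 2 * (R ^ N / N) *
      ((r ^ (N - 1) * (r ^ (N - 1) * g r)) * ionEnergy N A B p q R U r) with hE
  set b := B * Real.exp (-(q * U r)) / boltzmannMass N R (fun s => -(q * U s)) with hb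
  have hb0 : 0 ≤ b := by positivity
  -- Up to the bounded co-ion density `b`, the ion difference is `p` times the energy density, which
  -- the energy estimate expresses through the squared flux.
  have hf : ionDifference N A B p q R U r =
      p * ionEnergy N A B p q R U r - (1 + p / q) * b := by
    simp only [ionDifference, ionEnergy, hb]
    field_simp
    ring
  have hV : flux N R g ε U r ^ 2 = 2 * E + 2 * (ε ^ 2 * (R ^ N / N) *
      ((r ^ (N - 1) * (r ^ (N - 1) * g r)) * ionEnergy N A B p q R U r)) := by
    rw [hE]; ring
  have hid : ε ^ 2 * (r ^ (N - 1) * (R ^ N / N * ionDifference N A B p q R U r)) -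
        p / 2 * flux N R g ε U r ^ 2 * (r ^ (N - 1) * g r)⁻¹ =
      -(p * (r ^ (N - 1) * g r)⁻¹ * E) -
        ε ^ 2 * (r ^ (N - 1) * (R ^ N / N) * (1 + p / q) * b) := by
    rw [hV, hf]
    linear_combination (-(p * ε ^ 2 * (R ^ N / N) * r ^ (N - 1) *
      ionEnergy N A B p q R U r)) * mul_inv_cancel₀ hh.ne'
  rw [hid]
  have t1 : |p * (r ^ (N - 1) * g r)⁻¹ * E| ≤
      p * M * (ε ^ 2 * (R ^ N / N) * C * (A / p + B / q)) := by
    rw [abs_mul, abs_mul, abs_of_pos hp]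
    have := hM r hrI
    rw [Real.norm_eq_abs] at this
    gcongr
  have t2 : b ≤ B * N / (R / 2) ^ N := by
    refine e2.trans ?_
    have := hr.1.le
    gcongr
  have t3 : |ε ^ 2 * (r ^ (N - 1) * (R ^ N / N) * (1 + p / q) * b)| ≤
      ε ^ 2 * (R ^ (N - 1) * (R ^ N / N) * (1 + p / q) * (B * N / (R / 2) ^ N)) := by
    rw [abs_of_nonneg (by positivity)]
    have := hr.2.le
    gcongr
  have t4 := abs_sub (-(p * (r ^ (N - 1) * g r)⁻¹ * E))
    (ε ^ 2 * (r ^ (N - 1) * (R ^ N / N) * (1 + p / q) * b))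
  rw [abs_neg] at t4
  linarith

/-- Stability of the Riccati equation `μ f' = κ f²` with terminal value `Q`. -/
theorem riccati_comparison {a b μ κ Q η : ℝ} (hab : a ≤ b) (hμ : 0 < μ) (hκ : 0 < κ)
    (hQ : 0 < Q) {f f' : ℝ → ℝ} (hf : ContinuousOn f (Icc a b))
    (hd : ∀ x ∈ Ioo a b, HasDerivAt f (f' x) x) (h0 : ∀ x ∈ Icc a b, f x ∈ Icc 0 Q)
    (hb : f b = Q) (hη : ∀ x ∈ Ioo a b, |μ * f' x - κ * f x ^ 2| ≤ η) :
    (f a - Q / (1 + κ * Q * (b - a) / μ)) ^ 2 ≤ 2 * Q * η * (b - a) / μ := by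
  set y : ℝ → ℝ := fun x => Q / (1 + κ * Q * (b - x) / μ) with hy
  have hpos : ∀ x ≤ b, 0 < 1 + κ * Q * (b - x) / μ := fun x hx => by
    have := sub_nonneg.2 hx
    positivity
  have hyd : ∀ x ≤ b, HasDerivAt y (κ * y x ^ 2 / μ) x := by
    intro x hx
    have h1 : HasDerivAt (fun x => 1 + κ * Q * (b - x) / μ) (κ * Q * (-1) / μ) x :=
      ((((hasDerivAt_id x).const_sub b).const_mul (κ * Q)).div_const μ).const_add 1
    refine ((hasDerivAt_const x Q).div h1 (hpos x hx).ne').congr_deriv ?_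
    have := hpos x hx
    simp only [hy]
    field_simp
    ring
  have hy0 : ∀ x ≤ b, y x ∈ Icc 0 Q := fun x hx =>
    ⟨(div_pos hQ (hpos x hx)).le, div_le_self hQ.le (by
      have := sub_nonneg.2 hx
      have : 0 ≤ κ * Q * (b - x) / μ := by positivity
      linarith)⟩
  have hyc : ContinuousOn y (Icc a b) := fun x hx => (hyd x hx.2).continuousAt.continuousWithinAt
  -- With e the Riccati error of f, half the derivative of (f-y)² is (κ (f-y)² (f+y) + (f-y)e)/μ.
  -- The cubic term is nonnegative and |(f-y)e| ≤ Qη, so going backward from `b` the gap grows at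
  -- most linearly, with no Gronwall exponential.
  have hm : MonotoneOn (fun x => (f x - y x) ^ 2 + 2 * Q * η / μ * x) (Icc a b) := by
    refine monotoneOn_Icc_of_hasDerivAt (by fun_prop)
      (fun x hx => (((hd x hx).sub (hyd x hx.2.le)).pow 2).add
        ((hasDerivAt_id x).const_mul (2 * Q * η / μ))) ?_
    intro x hx
    obtain ⟨f0, f1⟩ := h0 x (Ioo_subset_Icc_self hx)
    obtain ⟨y0, y1⟩ := hy0 x hx.2.le
    have hη0 := (abs_nonneg _).trans (hη x hx)
    set e := μ * f' x - κ * f x ^ 2 with he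
    have hf' : f' x = (κ * f x ^ 2 + e) / μ := by rw [he]; field_simp; ring
    have hω : |f x - y x| ≤ Q := abs_le.2 ⟨by linarith, by linarith⟩
    have hprod : -(Q * η) ≤ (f x - y x) * e := by
      have h1 := neg_abs_le ((f x - y x) * e)
      rw [abs_mul] at h1
      have h2 := mul_le_mul hω (hη x hx) (abs_nonneg _) hQ.le
      linarith
    have hsq : 0 ≤ κ * (f x - y x) ^ 2 * (f x + y x) := by positivity
    have : 0 ≤ 2 * (κ * (f x - y x) ^ 2 * (f x + y x) + ((f x - y x) * e + Q * η)) / μ :=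
      div_nonneg (by linarith) hμ.le
    refine this.trans_eq ?_
    simp only [Pi.sub_apply, hf']
    push_cast
    field_simp
    ring
  have := hm (left_mem_Icc.2 hab) (right_mem_Icc.2 hab) hab
  have hyb : y b = Q := by simp [hy]
  simp only [hb, hyb, sub_self] at this
  have e : 2 * Q * η * (b - a) / μ = 2 * Q * η / μ * b - 2 * Q * η / μ * a := by ring
  rw [e]
  change (f a - y a) ^ 2 ≤ _
  linarith

/-- Continuity at `R` freezes the weight across a shrinking layer. The first conjunct places the
layer in the outer half of the interval, where the Riccati bound is available. -/
theorem eventually_inv_weight_close (hg : IsDielectric R g) (hR : 0 < R) (T : ℝ)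
    {η : ℝ} (hη : 0 < η) :
    ∀ᶠ ε in 𝓝[>] (0 : ℝ), T * ε ^ 2 < R / 2 ∧ ∀ r ∈ Ioo 0 R, R - r ≤ T * ε ^ 2 →
      |(r ^ (N - 1) * g r)⁻¹ - (R ^ (N - 1) * g R)⁻¹| ≤ η := by
  have hRm : R ∈ Icc 0 R := right_mem_Icc.2 hR.le
  have hc : ContinuousWithinAt (fun r => (r ^ (N - 1) * g r)⁻¹) (Icc 0 R) R := by
    have := hg.1.continuousOn R hRm
    have hgR := hg.2 R hRm
    exact ContinuousWithinAt.inv₀ (by fun_prop) (by positivity)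
  obtain ⟨δ, hδ, h⟩ := Metric.continuousWithinAt_iff.1 hc η hη
  have ht : Tendsto (fun ε : ℝ => T * ε ^ 2) (𝓝[>] 0) (𝓝 0) := by
    have : Tendsto (fun ε : ℝ => T * ε ^ 2) (𝓝 0) (𝓝 (T * 0 ^ 2)) :=
      Continuous.tendsto (by fun_prop) 0
    simp only [ne_eq, OfNat.ofNat_ne_zero, not_false_eq_true, zero_pow, mul_zero] at this
    exact this.mono_left nhdsWithin_le_nhds
  filter_upwards [ht.eventually_lt_const (half_pos hR), ht.eventually_lt_const hδ]
    with ε h1 h2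
  refine ⟨h1, fun r hr hrT => (h (Ioo_subset_Icc_self hr) ?_).le⟩
  rw [Real.dist_eq, abs_sub_comm, abs_of_pos (sub_pos.2 hr.2)]
  linarith

/-- The flux converges, uniformly in layers of thickness of order `ε²`. -/
theorem eventually_flux_close (hg : IsDielectric R g) (hN : 2 ≤ N) (hR : 0 < R)
    (hA : 0 < A) (hB : 0 < B) (hp : 0 < p) (hq : 0 < q) (hBA : B < A) {T η : ℝ} (hT : 0 < T)
    (hη : 0 < η) {κ Q : ℝ} (hκ : κ = p / 2 * (R ^ (N - 1) * g R)⁻¹)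
    (hQ : Q = R ^ N / N * (A - B)) :
    ∀ᶠ ε in 𝓝[>] (0 : ℝ), ∀ U, IsNeumannSolution N A B p q R g ε U → ∀ r ∈ Ioo 0 R,
      R - r ≤ T * ε ^ 2 →
        |flux N R g ε U r - Q / (1 + κ * Q * (R - r) / ε ^ 2)| ≤ η := by
  have hN0 : (0 : ℝ) < N := by exact_mod_cast (by omega : 0 < N)
  have hgR := hg.2 R (right_mem_Icc.2 hR.le)
  have hQ0 : 0 < Q := by
    have := sub_pos.2 hBA
    rw [hQ]; positivity
  have hκ0 : 0 < κ := by rw [hκ]; positivity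
  obtain ⟨C, hC0, hC⟩ := exists_flux_riccati_bound hg hN hR hA hB hp hq hBA
  -- The total Riccati error allowed, since the comparison controls the square of the gap. Half goes
  -- to the O(ε²) remainder and half to freezing the weight.
  obtain ⟨η₁, hη₁, hη₁'⟩ : ∃ η₁, 0 < η₁ ∧ 2 * Q * η₁ * T ≤ η ^ 2 :=
    ⟨η ^ 2 / (2 * Q * T), by positivity, le_of_eq (by field_simp)⟩
  have ht : Tendsto (fun ε : ℝ => C * ε ^ 2) (𝓝[>] 0) (𝓝 0) := by
    have : Tendsto (fun ε : ℝ => C * ε ^ 2) (𝓝 0) (𝓝 (C * 0 ^ 2)) :=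
      Continuous.tendsto (by fun_prop) 0
    simp only [ne_eq, OfNat.ofNat_ne_zero, not_false_eq_true, zero_pow, mul_zero] at this
    exact this.mono_left nhdsWithin_le_nhds
  have hη₂ : 0 < η₁ / 2 / (p / 2 * Q ^ 2) := by positivity
  filter_upwards [ht.eventually_lt_const (half_pos hη₁), self_mem_nhdsWithin,
    eventually_inv_weight_close (N := N) hg hR T hη₂] with ε h1 hε h2 U S r hr hrT
  have hε : 0 < ε := hε
  have hbd : ∀ x ∈ Icc 0 R, flux N R g ε U x ∈ Icc 0 Q := fun x hx =>
    ⟨S.flux_nonneg hg hN hR hA hB hp hq hBA hε hx,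
      hQ ▸ S.flux_le hg hN hR hA hB hp hq hBA hε hx⟩
  have hsub : Icc r R ⊆ Icc 0 R := Icc_subset_Icc_left hr.1.le
  have hcmp := riccati_comparison (f := flux N R g ε U) (η := η₁) hr.2.le
    (show 0 < ε ^ 2 by positivity) hκ0 hQ0 ((S.continuousOn_flux hg hR).mono hsub)
    (fun x hx => S.hasDerivAt_flux hg hN ⟨hr.1.trans hx.1, hx.2⟩)
    (fun x hx => hbd x (hsub hx)) (hQ ▸ S.flux_boundary hg hR hN hε) (by
      intro x hx
      have hx' : x ∈ Ioo 0 R := ⟨hr.1.trans hx.1, hx.2⟩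
      have hxT : R - x ≤ T * ε ^ 2 := by linarith [hx.1]
      have a1 := hC ε U hε S x ⟨by linarith [h2.1], hx.2⟩
      have a2 := h2.2 x hx' hxT
      obtain ⟨f0, f1⟩ := hbd x (Ioo_subset_Icc_self hx')
      have a3 : |p / 2 * flux N R g ε U x ^ 2 *
          ((x ^ (N - 1) * g x)⁻¹ - (R ^ (N - 1) * g R)⁻¹)| ≤ η₁ / 2 := by
        rw [abs_mul, abs_of_nonneg (by positivity)]
        calc _ ≤ p / 2 * Q ^ 2 * (η₁ / 2 / (p / 2 * Q ^ 2)) := by gcongr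
          _ = η₁ / 2 := by field_simp
      have a4 := abs_add_le (ε ^ 2 * (x ^ (N - 1) * (R ^ N / N *
        ionDifference N A B p q R U x)) -
          p / 2 * flux N R g ε U x ^ 2 * (x ^ (N - 1) * g x)⁻¹)
          (p / 2 * flux N R g ε U x ^ 2 *
          ((x ^ (N - 1) * g x)⁻¹ - (R ^ (N - 1) * g R)⁻¹))
      refine le_trans (le_of_eq ?_) (a4.trans (by linarith))
      congr 1
      rw [hκ]
      ring)
  refine abs_le_of_sq_le_sq (hcmp.trans (le_trans ?_ hη₁')) hη.le
  rw [div_le_iff₀ (by positivity)]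
  have := mul_le_mul_of_nonneg_left hrT (show 0 ≤ 2 * Q * η₁ by positivity)
  linarith

/-- The potential difference converges, uniformly in layers of thickness of order `ε²`. -/
theorem eventually_potential_close (hg : IsDielectric R g) (hN : 2 ≤ N) (hR : 0 < R)
    (hA : 0 < A) (hB : 0 < B) (hp : 0 < p) (hq : 0 < q) (hBA : B < A) {T η : ℝ} (hT : 0 < T)
    (hη : 0 < η) {κ Q : ℝ} (hκ : κ = p / 2 * (R ^ (N - 1) * g R)⁻¹)
    (hQ : Q = R ^ N / N * (A - B)) :
    ∀ᶠ ε in 𝓝[>] (0 : ℝ), ∀ U, IsNeumannSolution N A B p q R g ε U → ∀ r ∈ Ioo 0 R,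
      R - r ≤ T * ε ^ 2 →
        |U R - U r - 2 / p * Real.log (1 + κ * Q * (R - r) / ε ^ 2)| ≤ η := by
  have hN0 : (0 : ℝ) < N := by exact_mod_cast (by omega : 0 < N)
  have hgR := hg.2 R (right_mem_Icc.2 hR.le)
  have hQ0 : 0 < Q := by
    have := sub_pos.2 hBA
    rw [hQ]; positivity
  have hκ0 : 0 < κ := by rw [hκ]; positivity
  have hη₁ : 0 < η / (2 * T) / Q := by positivity
  have hη₂ : 0 < η / (2 * T) * (R ^ (N - 1) * g R) := by positivity
  filter_upwards [self_mem_nhdsWithin, eventually_inv_weight_close (N := N) hg hR T hη₁,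
    eventually_flux_close hg hN hR hA hB hp hq hBA hT hη₂ hκ hQ] with ε hε h1 h2 U S r hr hrT
  have hε : 0 < ε := hε
  have hsub : Icc r R ⊆ Icc 0 R := Icc_subset_Icc_left hr.1.le
  set W : ℝ → ℝ := fun x => U R - U x - 2 / p * Real.log (1 + κ * Q * (R - x) / ε ^ 2) with hW
  have hpos : ∀ x ≤ R, 0 < 1 + κ * Q * (R - x) / ε ^ 2 := fun x hx => by
    have := sub_nonneg.2 hx
    positivity
  have hWc : ContinuousOn W (Icc r R) := by
    have := S.continuousOn.mono hsub
    have : ContinuousOn (fun x => Real.log (1 + κ * Q * (R - x) / ε ^ 2)) (Icc r R) :=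
      ContinuousOn.log (by fun_prop) fun x hx => (hpos x hx.2).ne'
    fun_prop
  have hWd : ∀ x ∈ Ioo 0 R, HasDerivAt W ((Q / (1 + κ * Q * (R - x) / ε ^ 2) *
      (R ^ (N - 1) * g R)⁻¹ - flux N R g ε U x * (x ^ (N - 1) * g x)⁻¹) / ε ^ 2) x := by
    intro x hx
    have hx0 := hx.1
    have hgx := hg.2 x (Ioo_subset_Icc_self hx)
    have hl : HasDerivAt (fun x => 1 + κ * Q * (R - x) / ε ^ 2) (κ * Q * (-1) / ε ^ 2) x :=
      ((((hasDerivAt_id x).const_sub R).const_mul (κ * Q)).div_const (ε ^ 2)).const_add 1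
    refine (((S.hasDerivAt hx).const_sub (U R)).sub
      ((hl.log (hpos x hx.2.le).ne').const_mul (2 / p))).congr_deriv ?_
    have hx1 := hpos x hx.2.le
    have e1 : flux N R g ε U x * (x ^ (N - 1) * g x)⁻¹ / ε ^ 2 =
        derivWithin U (Icc 0 R) x := by
      rw [flux]; field_simp
    -- This makes the logarithm the exact primitive of the limiting flux divided by the frozen
    -- weight.
    have e2 : (2 / p) * κ = (R ^ (N - 1) * g R)⁻¹ := by rw [hκ]; field_simp
    rw [sub_div, e1, ← e2]
    ring
  have hbound : ∀ x ∈ Ico r R, ‖(Q / (1 + κ * Q * (R - x) / ε ^ 2) *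
      (R ^ (N - 1) * g R)⁻¹ - flux N R g ε U x * (x ^ (N - 1) * g x)⁻¹) / ε ^ 2‖ ≤
      η / T / ε ^ 2 := by
    intro x hx
    have hx' : x ∈ Ioo 0 R := ⟨hr.1.trans_le hx.1, hx.2⟩
    have hxT : R - x ≤ T * ε ^ 2 := by linarith [hx.1]
    have a1 := h1.2 x hx' hxT
    have a2 := h2 U S x hx' hxT
    have f0 := S.flux_nonneg hg hN hR hA hB hp hq hBA hε (Ioo_subset_Icc_self hx')
    have f1 := S.flux_le hg hN hR hA hB hp hq hBA hε (Ioo_subset_Icc_self hx')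
    rw [← hQ] at f1
    rw [Real.norm_eq_abs, abs_div, abs_of_pos (show 0 < ε ^ 2 by positivity)]
    gcongr
    have b1 : |(flux N R g ε U x - Q / (1 + κ * Q * (R - x) / ε ^ 2)) *
        (R ^ (N - 1) * g R)⁻¹| ≤ η / (2 * T) := by
      rw [abs_mul, abs_of_pos (show 0 < (R ^ (N - 1) * g R)⁻¹ by positivity)]
      calc _ ≤ η / (2 * T) * (R ^ (N - 1) * g R) * (R ^ (N - 1) * g R)⁻¹ := by gcongr
        _ = _ := by field_simp
    have b2 : |flux N R g ε U x * ((x ^ (N - 1) * g x)⁻¹ - (R ^ (N - 1) * g R)⁻¹)| ≤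
        η / (2 * T) := by
      rw [abs_mul, abs_of_nonneg f0]
      calc _ ≤ Q * (η / (2 * T) / Q) := by gcongr
        _ = _ := by field_simp
    have b3 := abs_add_le ((flux N R g ε U x - Q / (1 + κ * Q * (R - x) / ε ^ 2)) *
        (R ^ (N - 1) * g R)⁻¹)
        (flux N R g ε U x * ((x ^ (N - 1) * g x)⁻¹ - (R ^ (N - 1) * g R)⁻¹))
    rw [abs_sub_comm]
    have e3 : η / T = η / (2 * T) + η / (2 * T) := by field_simp; ring
    rw [e3]
    refine le_trans (le_of_eq ?_) (b3.trans (add_le_add b1 b2))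
    congr 1
    ring
  -- The derivative is small only relative to ε⁻²; the layer length `T * ε ^ 2` compensates exactly.
  have hmv := norm_image_sub_le_of_norm_deriv_right_le_segment hWc
    (fun x hx => (hWd x ⟨hr.1.trans_le hx.1, hx.2⟩).hasDerivWithinAt) hbound R
    (right_mem_Icc.2 hr.2.le)
  have hWR : W R = 0 := by simp [hW]
  rw [hWR, zero_sub, norm_neg, Real.norm_eq_abs] at hmv
  refine hmv.trans ?_
  calc η / T / ε ^ 2 * (R - r) ≤ η / T / ε ^ 2 * (T * ε ^ 2) := by gcongr
    _ = η := by field_simp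

end Family

/-! ### Monotonicity of the explicit limit -/

section Profile

/-- The dimensionless profile of the limiting capacitance. -/
noncomputable def layerProfile (x : ℝ) : ℝ := x / ((1 + x) * Real.log (1 + x))

theorem layerProfile_pos {x : ℝ} (hx : 0 < x) : 0 < layerProfile x := by
  have := Real.log_pos (show 1 < 1 + x by linarith)
  unfold layerProfile
  positivity

theorem layerProfile_lt_one {x : ℝ} (hx : 0 < x) : layerProfile x < 1 := by
  have h0 := Real.log_pos (show 1 < 1 + x by linarith)
  have h1 : 0 < 1 + x := by linarith
  rw [layerProfile, div_lt_one (by positivity)]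
  have h := Real.log_lt_sub_one_of_pos (inv_pos.2 h1) (inv_ne_one.2 (by linarith))
  rw [Real.log_inv] at h
  have := mul_lt_mul_of_pos_left h h1
  rw [mul_sub, mul_inv_cancel₀ h1.ne'] at this
  linarith

/-- The reciprocal is the secant slope of t log t between 1 and 1 + x, which increases by strict
convexity. -/
theorem layerProfile_strictAntiOn : StrictAntiOn layerProfile (Ioi 0) := by
  intro x hx y hy hxy
  have hx : 0 < x := hx
  have hy : 0 < y := hy
  have hlx := Real.log_pos (show 1 < 1 + x by linarith)
  have hly := Real.log_pos (show 1 < 1 + y by linarith)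
  have h := Real.strictConvexOn_mul_log.secant_strict_mono (a := 1) (x := 1 + x) (y := 1 + y)
    (by simp) (by simp; linarith) (by simp; linarith) (by linarith) (by linarith) (by linarith)
  simp only [Real.log_one, mul_zero, sub_zero, add_sub_cancel_left] at h
  rw [div_lt_div_iff₀ hx hy] at h
  unfold layerProfile
  rw [div_lt_div_iff₀ (by positivity) (by positivity)]
  linarith

/-- The product splits as x/log(1+x) times x/(1+x). The first factor increases because secant slopes
of the concave logarithm decrease; the second is clear. -/
theorem mul_layerProfile_strictMonoOn : StrictMonoOn (fun x => x * layerProfile x) (Ioi 0) := by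
  intro x hx y hy hxy
  have hx : 0 < x := hx
  have hy : 0 < y := hy
  have hlx := Real.log_pos (show 1 < 1 + x by linarith)
  have hly := Real.log_pos (show 1 < 1 + y by linarith)
  have h := strictConcaveOn_log_Ioi.secant_strict_mono (a := 1) (x := 1 + x) (y := 1 + y)
    (by simp) (by simp; linarith) (by simp; linarith) (by linarith) (by linarith) (by linarith)
  simp only [Real.log_one, sub_zero, add_sub_cancel_left] at h
  rw [div_lt_div_iff₀ hy hx] at h
  have h1 : x / Real.log (1 + x) < y / Real.log (1 + y) := by
    rw [div_lt_div_iff₀ hlx hly]; linarith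
  have h2 : x / (1 + x) < y / (1 + y) := by
    rw [div_lt_div_iff₀ (by linarith) (by linarith)]; nlinarith
  have h3 := mul_lt_mul'' h1 h2 (by positivity) (by positivity)
  have e : ∀ x, x * layerProfile x = x / Real.log (1 + x) * (x / (1 + x)) := by
    intro x; rw [layerProfile, div_mul_div_comm, mul_div_assoc', mul_comm (1 + x)]
  simp only [e]
  exact h3

variable {N : ℕ} {D z k R γ : ℝ}

theorem limitCapacitance_eq (hN : 0 < N) (hD : 0 < D) (hz : 0 < z) (hk : 0 < k) (hR : 0 < R)
    (hγ : 0 < γ) : limitCapacitance N D z k R γ =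
      R ^ N * D * z / (2 * N) * layerProfile (R * D * γ * z / (2 * N * k)) := by
  have hN0 : (0 : ℝ) < N := by exact_mod_cast hN
  have hx : 0 < R * D * γ * z / (2 * N * k) := by positivity
  have hl := Real.log_pos (show 1 < 1 + R * D * γ * z / (2 * N * k) by linarith)
  rw [limitCapacitance, layerProfile]
  set l := Real.log (1 + R * D * γ * z / (2 * N * k))
  have h1 : (0 : ℝ) < 1 + 2 * N * k / (R * D * γ * z) := by positivity
  field_simp
  ring

theorem limitCapacitance_strictAntiOn (hN : 0 < N) (hD : 0 < D) (hz : 0 < z) (hk : 0 < k)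
    (hR : 0 < R) : StrictAntiOn (fun γ => limitCapacitance N D z k R γ) (Ioi 0) := by
  have hN0 : (0 : ℝ) < N := by exact_mod_cast hN
  intro γ₁ h1 γ₂ h2 h
  have h1 : 0 < γ₁ := h1
  have h2 : 0 < γ₂ := h2
  simp only [limitCapacitance_eq hN hD hz hk hR h1, limitCapacitance_eq hN hD hz hk hR h2]
  have := layerProfile_strictAntiOn
    (show R * D * γ₁ * z / (2 * N * k) ∈ Ioi 0 from by simp only [mem_Ioi]; positivity)
    (show R * D * γ₂ * z / (2 * N * k) ∈ Ioi 0 from by simp only [mem_Ioi]; positivity)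
    (by gcongr)
  gcongr

theorem limitCapacitance_lt (hN : 0 < N) (hD : 0 < D) (hz : 0 < z) (hk : 0 < k) (hR : 0 < R)
    (hγ : 0 < γ) : limitCapacitance N D z k R γ < R ^ N * D * z / (2 * N) := by
  have hN0 : (0 : ℝ) < N := by exact_mod_cast hN
  rw [limitCapacitance_eq hN hD hz hk hR hγ]
  exact mul_lt_of_lt_one_right (by positivity) (layerProfile_lt_one (by positivity))

theorem limitCapacitance_strictMonoOn (hN : 0 < N) (hD : 0 < D) (hz : 0 < z) (hk : 0 < k)
    (hγ : 0 < γ) : StrictMonoOn (fun R => limitCapacitance N D z k R γ) (Ioi 0) := by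
  have hN0 : (0 : ℝ) < N := by exact_mod_cast hN
  intro R₁ h1 R₂ h2 h
  have h1 : 0 < R₁ := h1
  have h2 : 0 < R₂ := h2
  simp only [limitCapacitance_eq hN hD hz hk h1 hγ, limitCapacitance_eq hN hD hz hk h2 hγ]
  have hm := mul_layerProfile_strictMonoOn
    (show R₁ * D * γ * z / (2 * N * k) ∈ Ioi 0 from by simp only [mem_Ioi]; positivity)
    (show R₂ * D * γ * z / (2 * N * k) ∈ Ioi 0 from by simp only [mem_Ioi]; positivity)
    (by gcongr)
  have hpos := layerProfile_pos (show 0 < R₁ * D * γ * z / (2 * N * k) by positivity)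
  -- The profile itself decreases in `R`. One power of `R` from the prefactor is absorbed to form
  -- xφ(x), leaving the nondecreasing factor `R ^ (N - 1)`.
  have e : ∀ R, R ^ N * D * z / (2 * N) * layerProfile (R * D * γ * z / (2 * N * k)) =
      k / γ * (R ^ (N - 1) * (R * D * γ * z / (2 * N * k) *
        layerProfile (R * D * γ * z / (2 * N * k)))) := by
    intro R
    obtain ⟨n, rfl⟩ : ∃ n, N = n + 1 := ⟨N - 1, by omega⟩
    simp only [Nat.add_sub_cancel]
    field_simp
    ring
  rw [e, e]
  refine mul_lt_mul_of_pos_left ?_ (by positivity)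
  exact mul_lt_mul' (by gcongr) hm (by positivity) (by positivity)

theorem limitCapacitance_monotoneOn_dielectric (hN : 0 < N) (hD : 0 < D) (hz : 0 < z)
    (hR : 0 < R) (hγ : 0 < γ) :
    MonotoneOn (fun k => limitCapacitance N D z k R γ) (Ioi 0) := by
  have hN0 : (0 : ℝ) < N := by exact_mod_cast hN
  intro k₁ h1 k₂ h2 h
  have h1 : 0 < k₁ := h1
  have h2 : 0 < k₂ := h2
  simp only [limitCapacitance_eq hN hD hz h1 hR hγ, limitCapacitance_eq hN hD hz h2 hR hγ]
  have := layerProfile_strictAntiOn.antitoneOn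
    (show R * D * γ * z / (2 * N * k₂) ∈ Ioi 0 from by simp only [mem_Ioi]; positivity)
    (show R * D * γ * z / (2 * N * k₁) ∈ Ioi 0 from by simp only [mem_Ioi]; positivity)
    (by gcongr)
  gcongr

end Profile

/-! ### Limits of the capacitance -/

section Limits

variable {N : ℕ} {A B p q R : ℝ} {g : ℝ → ℝ} {U : ℝ → ℝ → ℝ}

theorem IsNeumannSolution.capacitance_eq {ε : ℝ} {U : ℝ → ℝ}
    (S : IsNeumannSolution N A B p q R g ε U) (hg : IsDielectric R g) (hN : 2 ≤ N) (hR : 0 < R)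
    (hA : 0 < A) (hB : 0 < B) (hp : 0 < p) (hq : 0 < q) (hBA : B < A) (hε : 0 < ε) {r : ℝ}
    (hr : r ∈ Ioo 0 R) : capacitance N A B p q R U r =
      (R ^ N / N * (A - B) - flux N R g ε U r) / (U R - U r) := by
  have h1 := S.flux_le hg hN hR hA hB hp hq hBA hε (Ioo_subset_Icc_self hr)
  have h2 := S.lt_boundary hg hN hR hA hB hp hq hBA hε hr
  rw [capacitance, S.integral_charge hg hN hR hr, S.flux_boundary hg hR hN hε, abs_div,
    abs_of_nonpos (sub_nonpos.2 h1), abs_of_pos (sub_pos.2 h2), neg_sub]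

theorem tendsto_of_eventually_close {u y : ℝ → ℝ} {l : Filter ℝ} {L : ℝ}
    (h : ∀ η > 0, ∀ᶠ ε in l, |u ε - y ε| ≤ η) (hy : Tendsto y l (𝓝 L)) :
    Tendsto u l (𝓝 L) := by
  have h0 : Tendsto (fun ε => u ε - y ε) l (𝓝 0) := by
    rw [Metric.tendsto_nhds]
    intro η hη
    filter_upwards [h (η / 2) (half_pos hη)] with ε hε
    rw [Real.dist_eq, sub_zero]
    linarith
  simpa using h0.add hy

theorem IsNeumannFamily.tendsto_capacitance_of_lt (hU : IsNeumannFamily N A B p q R g U)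
    (hg : IsDielectric R g) (hN : 2 ≤ N) (hR : 0 < R) (hA : 0 < A) (hB : 0 < B) (hp : 0 < p)
    (hq : 0 < q) (hBA : B < A) {γ : ℝ} (hγ : 0 < γ) {r : ℝ → ℝ}
    (hr : HasScaledThickness R γ r) :
    Tendsto (fun ε => capacitance N A B p q R (U ε) (r ε)) (𝓝[>] 0)
      (𝓝 (limitCapacitance N (A - B) p (g R) R γ)) := by
  have hN0 : (0 : ℝ) < N := by exact_mod_cast (by omega : 0 < N)
  have hgR := hg.2 R (right_mem_Icc.2 hR.le)
  have hD : 0 < A - B := sub_pos.2 hBA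
  obtain ⟨Q, hQ⟩ : ∃ Q, Q = R ^ N / N * (A - B) := ⟨_, rfl⟩
  obtain ⟨κ, hκ⟩ : ∃ κ, κ = p / 2 * (R ^ (N - 1) * g R)⁻¹ := ⟨_, rfl⟩
  have hQ0 : 0 < Q := by rw [hQ]; positivity
  have hκ0 : 0 < κ := by rw [hκ]; positivity
  have hx : 0 < κ * Q * γ := by positivity
  have hl := Real.log_pos (show 1 < 1 + κ * Q * γ by linarith)
  -- Any constant above γ would do: the uniform layer estimates need a fixed scaled thickness.
  have hT : ∀ᶠ ε in 𝓝[>] (0 : ℝ), R - r ε ≤ (γ + 1) * ε ^ 2 := by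
    filter_upwards [hr.2.eventually_lt_const (lt_add_one γ), self_mem_nhdsWithin] with ε h hε
    have hε : 0 < ε := hε
    exact ((div_lt_iff₀ (by positivity)).1 h).le
  have harg : Tendsto (fun ε => 1 + κ * Q * (R - r ε) / ε ^ 2) (𝓝[>] 0)
      (𝓝 (1 + κ * Q * γ)) := by
    simp only [mul_div_assoc]
    exact (hr.2.const_mul _).const_add 1
  have hflux : Tendsto (fun ε => flux N R g ε (U ε) (r ε)) (𝓝[>] 0)
      (𝓝 (Q / (1 + κ * Q * γ))) := by
    refine tendsto_of_eventually_close (fun η hη => ?_)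
      (tendsto_const_nhds.div harg (by linarith))
    filter_upwards [hT, self_mem_nhdsWithin, eventually_flux_close hg hN hR hA hB hp hq hBA
      (T := γ + 1) (by linarith) hη hκ hQ] with ε h1 hε h2
    exact h2 _ (hU ε hε) _ (hr.1 ε hε) h1
  have hpot : Tendsto (fun ε => U ε R - U ε (r ε)) (𝓝[>] 0)
      (𝓝 (2 / p * Real.log (1 + κ * Q * γ))) := by
    refine tendsto_of_eventually_close (fun η hη => ?_)
      ((harg.log (by linarith)).const_mul (2 / p))
    filter_upwards [hT, self_mem_nhdsWithin, eventually_potential_close hg hN hR hA hB hp hq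
      hBA (T := γ + 1) (by linarith) hη hκ hQ] with ε h1 hε h2
    exact h2 _ (hU ε hε) _ (hr.1 ε hε) h1
  have hlim := (hflux.const_sub Q).div hpot (by positivity)
  have heq : (Q - Q / (1 + κ * Q * γ)) / (2 / p * Real.log (1 + κ * Q * γ)) =
      limitCapacitance N (A - B) p (g R) R γ := by
    have hxe : κ * Q * γ = R * (A - B) * γ * p / (2 * N * g R) := by
      obtain ⟨n, rfl⟩ : ∃ n, N = n + 1 := ⟨N - 1, by omega⟩
      rw [hκ, hQ]
      simp only [Nat.add_sub_cancel]
      field_simp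
      ring
    rw [limitCapacitance_eq (by omega) hD hp hgR hR hγ, ← hxe, layerProfile]
    rw [show R ^ N * (A - B) * p / (2 * N) = Q * p / 2 by rw [hQ]; ring]
    set l := Real.log (1 + κ * Q * γ)
    generalize κ * Q * γ = x at *
    have : 0 < 1 + x := by linarith
    field_simp
    ring
  rw [← heq]
  refine hlim.congr' ?_
  filter_upwards [self_mem_nhdsWithin] with ε hε
  rw [(hU ε hε).capacitance_eq hg hN hR hA hB hp hq hBA hε (hr.1 ε hε), ← hQ]
  rfl

theorem IsNeumannFamily.tendsto_capacitance_zero_of_lt (hU : IsNeumannFamily N A B p q R g U)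
    (hg : IsDielectric R g) (hN : 2 ≤ N) (hR : 0 < R) (hA : 0 < A) (hB : 0 < B) (hp : 0 < p)
    (hq : 0 < q) (hBA : B < A) {r : ℝ → ℝ} (hr : HasInfiniteScaledThickness R r) :
    Tendsto (fun ε => capacitance N A B p q R (U ε) (r ε)) (𝓝[>] 0) (𝓝 0) := by
  have hN0 : (0 : ℝ) < N := by exact_mod_cast (by omega : 0 < N)
  have hgR := hg.2 R (right_mem_Icc.2 hR.le)
  have hD : 0 < A - B := sub_pos.2 hBA
  obtain ⟨Q, hQ⟩ : ∃ Q, Q = R ^ N / N * (A - B) := ⟨_, rfl⟩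
  obtain ⟨κ, hκ⟩ : ∃ κ, κ = p / 2 * (R ^ (N - 1) * g R)⁻¹ := ⟨_, rfl⟩
  have hQ0 : 0 < Q := by rw [hQ]; positivity
  have hκ0 : 0 < κ := by rw [hκ]; positivity
  have hpot : Tendsto (fun ε => U ε R - U ε (r ε)) (𝓝[>] 0) atTop := by
    rw [tendsto_atTop]
    intro M
    have hlog : Tendsto (fun T => 2 / p * Real.log (1 + κ * Q * T)) atTop atTop :=
      (Real.tendsto_log_atTop.comp (tendsto_atTop_add_const_left _ 1
        (tendsto_id.const_mul_atTop (mul_pos hκ0 hQ0)))).const_mul_atTop (by positivity)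
    obtain ⟨T, hTM, hT⟩ := ((hlog.eventually_ge_atTop (M + 1)).and
      (eventually_gt_atTop 0)).exists
    filter_upwards [hr.2.eventually_ge_atTop T, self_mem_nhdsWithin,
      eventually_inv_weight_close (N := N) hg hR T one_pos,
      eventually_potential_close hg hN hR hA hB hp hq hBA hT one_pos hκ hQ] with ε h1 hε h2 h3
    have hε : 0 < ε := hε
    have hTε : 0 < T * ε ^ 2 := by positivity
    -- The layer estimate is applied at this intermediate point. As `r ε` lies further in and `U`
    -- increases, its potential drop is at least as large.
    have h4 : R - T * ε ^ 2 ∈ Ioo 0 R := ⟨by linarith [h2.1], by linarith⟩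
    have h5 := h3 _ (hU ε hε) _ h4 (by linarith)
    rw [sub_sub_cancel, show κ * Q * (T * ε ^ 2) / ε ^ 2 = κ * Q * T by field_simp] at h5
    have h6 := (abs_le.1 h5).1
    have h7 : T * ε ^ 2 ≤ R - r ε := (le_div_iff₀ (by positivity)).1 h1
    have h8 := (hU ε hε).monotoneOn hg hN hR hA hB hp hq hBA hε
      (Ioo_subset_Icc_self (hr.1 ε hε)) (Ioo_subset_Icc_self h4) (by linarith)
    linarith
  refine squeeze_zero' (Eventually.of_forall fun ε => abs_nonneg _) ?_ (hpot.const_div_atTop Q)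
  filter_upwards [self_mem_nhdsWithin] with ε hε
  have hS := hU ε hε
  rw [hS.capacitance_eq hg hN hR hA hB hp hq hBA hε (hr.1 ε hε), ← hQ]
  have h1 := hS.flux_nonneg hg hN hR hA hB hp hq hBA hε (Ioo_subset_Icc_self (hr.1 ε hε))
  have h2 := sub_pos.2 (hS.lt_boundary hg hN hR hA hB hp hq hBA hε (hr.1 ε hε))
  gcongr
  linarith

theorem IsNeumannFamily.neg (hU : IsNeumannFamily N A B p q R g U) :
    IsNeumannFamily N B A q p R g (fun ε r => -U ε r) := fun ε hε => (hU ε hε).neg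

theorem IsNeumannFamily.potential_difference_ne_zero (hU : IsNeumannFamily N A B p q R g U)
    (hg : IsDielectric R g) (hN : 2 ≤ N) (hR : 0 < R) (hA : 0 < A) (hB : 0 < B) (hp : 0 < p)
    (hq : 0 < q) (hAB : A ≠ B) {ε : ℝ} (hε : 0 < ε) {r : ℝ} (hr : r ∈ Ioo 0 R) :
    U ε R - U ε r ≠ 0 := by
  rcases hAB.lt_or_gt with h | h
  · have := (hU.neg ε hε).lt_boundary hg hN hR hB hA hq hp h hε hr
    simp only [neg_lt_neg_iff] at this
    exact (sub_neg.2 this).ne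
  · exact (sub_pos.2 ((hU ε hε).lt_boundary hg hN hR hA hB hp hq h hε hr)).ne'

theorem IsNeumannFamily.tendsto_capacitance (hU : IsNeumannFamily N A B p q R g U)
    (hg : IsDielectric R g) (hN : 2 ≤ N) (hR : 0 < R) (hA : 0 < A) (hB : 0 < B) (hp : 0 < p)
    (hq : 0 < q) (hAB : A ≠ B) {γ : ℝ} (hγ : 0 < γ) {r : ℝ → ℝ}
    (hr : HasScaledThickness R γ r) :
    Tendsto (fun ε => capacitance N A B p q R (U ε) (r ε)) (𝓝[>] 0)
      (𝓝 (limitCapacitance N |B - A| (layerValence A B p q) (g R) R γ)) := by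
  rcases hAB.lt_or_gt with h | h
  · have := hU.neg.tendsto_capacitance_of_lt hg hN hR hB hA hq hp h hγ hr
    simp only [capacitance_neg] at this
    rwa [abs_of_pos (sub_pos.2 h), layerValence, if_pos h]
  · rw [abs_sub_comm, abs_of_pos (sub_pos.2 h), layerValence, if_neg h.not_gt]
    exact hU.tendsto_capacitance_of_lt hg hN hR hA hB hp hq h hγ hr

theorem IsNeumannFamily.tendsto_capacitance_zero (hU : IsNeumannFamily N A B p q R g U)
    (hg : IsDielectric R g) (hN : 2 ≤ N) (hR : 0 < R) (hA : 0 < A) (hB : 0 < B) (hp : 0 < p)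
    (hq : 0 < q) (hAB : A ≠ B) {r : ℝ → ℝ} (hr : HasInfiniteScaledThickness R r) :
    Tendsto (fun ε => capacitance N A B p q R (U ε) (r ε)) (𝓝[>] 0) (𝓝 0) := by
  rcases hAB.lt_or_gt with h | h
  · have := hU.neg.tendsto_capacitance_zero_of_lt hg hN hR hB hA hq hp h hr
    simpa only [capacitance_neg] using this
  · exact hU.tendsto_capacitance_zero_of_lt hg hN hR hA hB hp hq h hr

end Limits

end ChargeConservingPB


/-! ### Assembly of the theorem -/

theorem theorem6p1 (N : ℕ) (hN : 2 ≤ N) (A B p q : ℝ)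
    (hA : 0 < A) (hB : 0 < B) (hp : 0 < p) (hq : 0 < q) (hAB : A ≠ B) :
    -- a fixed ball
    (∀ (R : ℝ) (g : ℝ → ℝ) (U : ℝ → ℝ → ℝ), 0 < R →
      ChargeConservingPB.IsDielectric R g →
      ChargeConservingPB.IsNeumannFamily N A B p q R g U →
      -- the potential difference does not vanish
      (∀ ε : ℝ, 0 < ε → ∀ r ∈ Ioo 0 R, U ε R - U ε r ≠ 0) ∧
      -- thick regions
      (∀ r : ℝ → ℝ, ChargeConservingPB.HasInfiniteScaledThickness R r →
        Tendsto (fun ε => ChargeConservingPB.capacitance N A B p q R (U ε) (r ε))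
          (𝓝[>] 0) (𝓝 0)) ∧
      -- regions of thickness comparable with the square of ε
      (∀ (γ : ℝ) (r : ℝ → ℝ), 0 < γ → ChargeConservingPB.HasScaledThickness R γ r →
        Tendsto (fun ε => ChargeConservingPB.capacitance N A B p q R (U ε) (r ε))
          (𝓝[>] 0)
          (𝓝 (ChargeConservingPB.limitCapacitance N |B - A|
            (ChargeConservingPB.layerValence A B p q) (g R) R γ))) ∧
      -- comparison in γ
      (∀ (γ₁ γ₂ : ℝ) (r₁ r₂ : ℝ → ℝ), 0 < γ₁ → γ₁ < γ₂ →
        ChargeConservingPB.HasScaledThickness R γ₁ r₁ →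
        ChargeConservingPB.HasScaledThickness R γ₂ r₂ →
        ∀ᶠ ε in 𝓝[>] (0 : ℝ),
          ChargeConservingPB.capacitance N A B p q R (U ε) (r₂ ε) <
              ChargeConservingPB.capacitance N A B p q R (U ε) (r₁ ε) ∧
            ChargeConservingPB.capacitance N A B p q R (U ε) (r₁ ε) <
              R ^ N * |B - A| * ChargeConservingPB.layerValence A B p q / (2 * N))) ∧
    -- comparison in R
    (∀ (R₁ R₂ : ℝ) (g₁ g₂ : ℝ → ℝ) (U₁ U₂ : ℝ → ℝ → ℝ) (γ : ℝ) (r₁ r₂ : ℝ → ℝ),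
      0 < R₁ → R₁ < R₂ →
      ChargeConservingPB.IsDielectric R₁ g₁ → ChargeConservingPB.IsDielectric R₂ g₂ →
      g₁ R₁ ≤ g₂ R₂ →
      ChargeConservingPB.IsNeumannFamily N A B p q R₁ g₁ U₁ →
      ChargeConservingPB.IsNeumannFamily N A B p q R₂ g₂ U₂ →
      0 < γ →
      ChargeConservingPB.HasScaledThickness R₁ γ r₁ →
      ChargeConservingPB.HasScaledThickness R₂ γ r₂ →
      ∀ᶠ ε in 𝓝[>] (0 : ℝ),
        ChargeConservingPB.capacitance N A B p q R₁ (U₁ ε) (r₁ ε) <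
          ChargeConservingPB.capacitance N A B p q R₂ (U₂ ε) (r₂ ε)) ∧
    -- the explicit limit: decreasing in γ, bounded, increasing in R
    (∀ k : ℝ, 0 < k →
      (∀ R : ℝ, 0 < R →
        StrictAntiOn (fun γ => ChargeConservingPB.limitCapacitance N |B - A|
          (ChargeConservingPB.layerValence A B p q) k R γ) (Ioi 0) ∧
        ∀ γ : ℝ, 0 < γ →
          ChargeConservingPB.limitCapacitance N |B - A|
              (ChargeConservingPB.layerValence A B p q) k R γ <
            R ^ N * |B - A| * ChargeConservingPB.layerValence A B p q / (2 * N)) ∧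
      (∀ γ : ℝ, 0 < γ →
        StrictMonoOn (fun R => ChargeConservingPB.limitCapacitance N |B - A|
          (ChargeConservingPB.layerValence A B p q) k R γ) (Ioi 0))) := by
  have hN0 : 0 < N := by omega
  have hD : 0 < |B - A| := abs_pos.2 (sub_ne_zero.2 hAB.symm)
  have hz : 0 < ChargeConservingPB.layerValence A B p q := by
    unfold ChargeConservingPB.layerValence
    split_ifs <;> assumption
  refine ⟨fun R g U hR hg hU => ⟨fun ε hε r hr => ?_, fun r hr => ?_, fun γ r hγ hr => ?_,
    fun γ₁ γ₂ r₁ r₂ hγ₁ hγ hr₁ hr₂ => ?_⟩,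
    fun R₁ R₂ g₁ g₂ U₁ U₂ γ r₁ r₂ hR₁ hR hg₁ hg₂ hg hU₁ hU₂ hγ hr₁ hr₂ => ?_,
    fun k hk => ⟨fun R hR => ⟨?_, fun γ hγ => ?_⟩, fun γ hγ => ?_⟩⟩
  · exact hU.potential_difference_ne_zero hg hN hR hA hB hp hq hAB hε hr
  · exact hU.tendsto_capacitance_zero hg hN hR hA hB hp hq hAB hr
  · exact hU.tendsto_capacitance hg hN hR hA hB hp hq hAB hγ hr
  · have hgR := hg.2 R (right_mem_Icc.2 hR.le)
    have h1 := hU.tendsto_capacitance hg hN hR hA hB hp hq hAB hγ₁ hr₁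
    have h2 := hU.tendsto_capacitance hg hN hR hA hB hp hq hAB (hγ₁.trans hγ) hr₂
    exact (h2.eventually_lt h1 (ChargeConservingPB.limitCapacitance_strictAntiOn hN0 hD hz hgR hR
      hγ₁ (hγ₁.trans hγ) hγ)).and (h1.eventually_lt_const
        (ChargeConservingPB.limitCapacitance_lt hN0 hD hz hgR hR hγ₁))
  · have hR₂ := hR₁.trans hR
    have hk₁ := hg₁.2 R₁ (right_mem_Icc.2 hR₁.le)
    have h1 := hU₁.tendsto_capacitance hg₁ hN hR₁ hA hB hp hq hAB hγ hr₁
    have h2 := hU₂.tendsto_capacitance hg₂ hN hR₂ hA hB hp hq hAB hγ hr₂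
    refine h1.eventually_lt h2 ?_
    -- First the radius is enlarged at fixed dielectric constant `g₁ R₁`, which is strict; then the
    -- constant is raised to `g₂ R₂` at radius `R₂`.
    exact (ChargeConservingPB.limitCapacitance_strictMonoOn hN0 hD hz hk₁ hγ hR₁ hR₂ hR).trans_le
      (ChargeConservingPB.limitCapacitance_monotoneOn_dielectric hN0 hD hz hR₂ hγ hk₁
        (hk₁.trans_le hg) hg)
  · exact ChargeConservingPB.limitCapacitance_strictAntiOn hN0 hD hz hk hR
  · exact ChargeConservingPB.limitCapacitance_lt hN0 hD hz hk hR hγ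
  · exact ChargeConservingPB.limitCapacitance_strictMonoOn hN0 hD hz hk hγ
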